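/- Let $n\ge 1$ be an integer, $I^n=[0,1]^n$ and $[n]=\{1,\dots,n\}$. For $k\ge 1$ let $\mathcal K_k^n$ be the family of the $k^n$ cubes $\prod_{s=1}^n\left[\frac{i_s-1}{k},\frac{i_s}{k}\right]$ with $i_s\in\{1,\dots,k\}$. A set $S\subset I^n$ connects the $i$th opposite faces of $I^n$ if $S$ is connected and contains a point $z$ with $z_i=0$ and a point $z'$ with $z'_i=1$; it connects some opposite faces if this holds for some $i\in[n]$. Consider the following two statements in dimension $n$. (B$_n$) For every continuous $f\colon I^n\to\mathbb R^{n-1}$ there are a point $p\in\mathbb R^{n-1}$ and a compact set $S\subset f^{-1}(\{p\})$ that connects some opposite faces of $I^n$. (C$_n$) ($n$-dimensional Steinhaus Chessboard Theorem.) For every $k\ge 1$ and every $F\colon\mathcal K_k^n\to[n]$ there are $c\in[n]$ and $\mathcal S\subset F^{-1}(\{c\})$ such that $\bigcup\mathcal S$ connects some opposite faces of $I^n$. Theorem. For every $n\ge 1$, (B$_n$) implies (C$_n$). More precisely, let $k\ge 1$ and $F\colon\mathcal K_k^n\to[n]$. Then there is a continuous map $f=(f_1,\dots,f_{n-1})\colon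 I^n\to\mathbb R^{n-1}$ such that $f_j^{-1}(\{0\})=\bigcup F^{-1}(\{j\})$ for every $1\le j\le n-1$. Moreover, for every such $f$, every $p\in\mathbb R^{n-1}$, every $i\in[n]$ and every set $S\subset f^{-1}(\{p\})$ that connects the $i$th opposite faces of $I^n$, there are $c\in[n]$ and $\mathcal S\subset F^{-1}(\{c\})$ such that $S\subset\bigcup\mathcal S$ and $\bigcup\mathcal S$ connects the $i$th opposite faces of $I^n$. -/

import Mathlib

namespace LevelSetChess

/-- `ℝⁿ` with its Euclidean norm. -/
abbrev Space (n : ℕ) : Type := EuclideanSpace ℝ (Fin n)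

/-- The unit cube `Iⁿ = [0,1]ⁿ`. -/
def unitCube (n : ℕ) : Set (Space n) := {x | ∀ s, x s ∈ Set.Icc (0 : ℝ) 1}

/-- The face `{z ∈ Iⁿ : z_i = 0}`. -/
def lowerFace {n : ℕ} (i : Fin n) : Set (Space n) := {z | z ∈ unitCube n ∧ z i = 0}

/-- The face `{z ∈ Iⁿ : z_i = 1}`. -/
def upperFace {n : ℕ} (i : Fin n) : Set (Space n) := {z | z ∈ unitCube n ∧ z i = 1}

/-- `S ⊆ Iⁿ` connects the `i`th opposite faces of `Iⁿ`. -/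
def ConnectsFaces {n : ℕ} (i : Fin n) (S : Set (Space n)) : Prop :=
  S ⊆ unitCube n ∧ IsConnected S ∧ (S ∩ lowerFace i).Nonempty ∧ (S ∩ upperFace i).Nonempty

/-- `S ⊆ Iⁿ` connects some opposite faces of `Iⁿ`. -/
def ConnectsSomeFaces {n : ℕ} (S : Set (Space n)) : Prop := ∃ i : Fin n, ConnectsFaces i S

/-- The small cube `∏ₛ [iₛ/k, (iₛ+1)/k]`, where each `iₛ` runs through `0, …, k-1`. -/
def smallCube (n k : ℕ) (i : Fin n → Fin k) : Set (Space n) :=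
  {x | ∀ s, x s ∈ Set.Icc (((i s : ℕ) : ℝ) / (k : ℝ)) ((((i s : ℕ) : ℝ) + 1) / (k : ℝ))}

/-- The division of `Iⁿ` into `kⁿ` small cubes. -/
def cubes (n k : ℕ) : Set (Set (Space n)) := Set.range (smallCube n k)

/-- The union of a family of small cubes. -/
def cubesUnion {n k : ℕ} (T : Set (cubes n k)) : Set (Space n) := ⋃ K ∈ T, (K : Set (Space n))

/-- The level set theorem in dimension `n`: every continuous map `Iⁿ → ℝⁿ⁻¹` has a fibre that
contains a compact set connecting some opposite faces of `Iⁿ`. -/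
def LevelSetTheorem (n : ℕ) : Prop :=
  ∀ f : Space n → Space (n - 1), ContinuousOn f (unitCube n) →
    ∃ (p : Space (n - 1)) (S : Set (Space n)),
      IsCompact S ∧ S ⊆ unitCube n ∩ f ⁻¹' {p} ∧ ConnectsSomeFaces S

/-- The Steinhaus Chessboard Theorem in dimension `n`. The colors `1, …, n` are `Fin n`. -/
def SteinhausChessboardTheorem (n : ℕ) : Prop :=
  ∀ k : ℕ, 1 ≤ k → ∀ F : cubes n k → Fin n,
    ∃ (c : Fin n) (T : Set (cubes n k)), T ⊆ F ⁻¹' {c} ∧ ConnectsSomeFaces (cubesUnion T)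

/-- `f = (f_1, …, f_{n-1}) : Iⁿ → ℝⁿ⁻¹` is continuous, and for each of the first `n - 1` colors `j`
the zero set of `f_j` in `Iⁿ` is the union of the cubes of color `j`. -/
def EncodesColoring {n k : ℕ} (F : cubes n k → Fin n) (f : Space n → Space (n - 1)) : Prop :=
  ContinuousOn f (unitCube n) ∧
    ∀ j : Fin (n - 1),
      {x | x ∈ unitCube n ∧ f x j = 0} = cubesUnion (F ⁻¹' {Fin.castLE (Nat.sub_le n 1) j})

end LevelSetChess

namespace LevelSetChess

/-! Let `f j` be the distance to the union of the cubes of color `j`, for all colors but the last.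
Every fibre over `p` is then covered by one color (`EncodesColoring.exists_color_cover`): color `j`
if `p j = 0`, the last color if no coordinate of `p` vanishes. A connected set in a fibre stays
connected when the cubes of that color meeting it are added (`connectsFaces_cubesUnion_meeting`). -/

lemma isClosed_smallCube (n k : ℕ) (i : Fin n → Fin k) : IsClosed (smallCube n k i) := by
  have h : smallCube n k i = ⋂ s, {x : Space n | x s ∈
      Set.Icc (((i s : ℕ) : ℝ) / (k : ℝ)) ((((i s : ℕ) : ℝ) + 1) / (k : ℝ))} := by
    ext x
    simp [smallCube]
  rw [h]
  exact isClosed_iInter fun s => isClosed_Icc.preimage (by fun_prop)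

lemma convex_smallCube (n k : ℕ) (i : Fin n → Fin k) : Convex ℝ (smallCube n k i) := by
  intro x hx y hy a b ha hb hab s
  exact convex_Icc _ _ (hx s) (hy s) ha hb hab

lemma smallCube_subset_unitCube {n k : ℕ} (i : Fin n → Fin k) :
    smallCube n k i ⊆ unitCube n := by
  intro x hx s
  have hk : 0 < (k : ℝ) := by exact_mod_cast (i s).pos
  have hi : ((i s : ℕ) : ℝ) + 1 ≤ k := by exact_mod_cast (i s).isLt
  exact ⟨le_trans (by positivity) (hx s).1, (hx s).2.trans ((div_le_one hk).2 hi)⟩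

lemma cubesUnion_subset_unitCube {n k : ℕ} (T : Set (cubes n k)) :
    cubesUnion T ⊆ unitCube n := by
  refine Set.iUnion₂_subset ?_
  rintro ⟨_, i, rfl⟩ _
  exact smallCube_subset_unitCube i

lemma isClosed_cubesUnion {n k : ℕ} (T : Set (cubes n k)) : IsClosed (cubesUnion T) := by
  have : Finite (cubes n k) := Set.finite_range (smallCube n k)
  refine T.toFinite.isClosed_biUnion ?_
  rintro ⟨_, i, rfl⟩ _
  exact isClosed_smallCube n k i

lemma exists_Icc_div_of_mem_unitInterval {k : ℕ} (hk : 1 ≤ k) {t : ℝ}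
    (ht : t ∈ Set.Icc (0 : ℝ) 1) :
    ∃ m : Fin k, t ∈ Set.Icc (((m : ℕ) : ℝ) / (k : ℝ)) ((((m : ℕ) : ℝ) + 1) / (k : ℝ)) := by
  have hk' : 0 < (k : ℝ) := by exact_mod_cast hk
  rcases ht.2.lt_or_eq with h1 | rfl
  · have h0 : 0 ≤ t * k := mul_nonneg ht.1 hk'.le
    refine ⟨⟨⌊t * k⌋₊, (Nat.floor_lt h0).2 (by nlinarith)⟩, ?_, ?_⟩
    · exact (div_le_iff₀ hk').2 (Nat.floor_le h0)
    · exact (le_div_iff₀ hk').2 (Nat.lt_floor_add_one _).le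
  -- At `t = 1` the floor would be `k`, out of range, so the last interval is used.
  · refine ⟨⟨k - 1, by omega⟩, ?_, ?_⟩ <;> simp only [Nat.cast_sub hk, Nat.cast_one]
    · exact (div_le_one hk').2 (by linarith)
    · exact (one_le_div hk').2 (by linarith)

lemma exists_cube_of_mem_unitCube {n k : ℕ} (hk : 1 ≤ k) {x : Space n} (hx : x ∈ unitCube n) :
    ∃ K : cubes n k, x ∈ (K : Set (Space n)) := by
  choose i hi using fun s => exists_Icc_div_of_mem_unitInterval hk (hx s)
  exact ⟨⟨_, i, rfl⟩, hi⟩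

/-- A closed set is the zero set of a continuous real function. -/
lemma exists_continuous_zeroSet_eq {X : Type*} [PseudoMetricSpace X] {A : Set X}
    (hA : IsClosed A) : ∃ g : X → ℝ, Continuous g ∧ ∀ x, g x = 0 ↔ x ∈ A := by
  rcases A.eq_empty_or_nonempty with rfl | hne
  -- `Metric.infDist` to `∅` is `0` by convention, so the distance function fails here.
  · exact ⟨fun _ => 1, continuous_const, by simp⟩
  · exact ⟨fun x => Metric.infDist x A, Metric.continuous_infDist_pt A,
      fun x => (hA.mem_iff_infDist_zero hne).symm⟩

lemma exists_encodesColoring {n k : ℕ} (F : cubes n k → Fin n) :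
    ∃ f : Space n → Space (n - 1), EncodesColoring F f := by
  choose g hg hg0 using fun j : Fin (n - 1) => exists_continuous_zeroSet_eq
    (isClosed_cubesUnion (F ⁻¹' {Fin.castLE (Nat.sub_le n 1) j}))
  refine ⟨fun x => WithLp.toLp 2 fun j => g j x, ?_, fun j => ?_⟩
  · exact ((PiLp.continuous_toLp 2 _).comp (continuous_pi hg)).continuousOn
  · ext x
    simp only [Set.mem_ofPred_eq, hg0]
    exact and_iff_right_of_imp fun h => cubesUnion_subset_unitCube _ h

/-- The cubes of one color that meet a connected set, if they cover it, have a connected union. -/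
lemma connectsFaces_cubesUnion_meeting {n k : ℕ} {S : Set (Space n)} {i : Fin n}
    (hS : ConnectsFaces i S) {C : Set (cubes n k)} (hC : S ⊆ cubesUnion C) :
    S ⊆ cubesUnion {K ∈ C | (S ∩ (K : Set (Space n))).Nonempty} ∧
      ConnectsFaces i (cubesUnion {K ∈ C | (S ∩ (K : Set (Space n))).Nonempty}) := by
  obtain ⟨-, hconn, hlow, hup⟩ := hS
  set T : Set (cubes n k) := {K ∈ C | (S ∩ (K : Set (Space n))).Nonempty}
  have hsub : S ⊆ cubesUnion T := by
    intro x hx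
    obtain ⟨K, hK, hxK⟩ := Set.mem_iUnion₂.1 (hC hx)
    exact Set.mem_iUnion₂.2 ⟨K, ⟨hK, x, hx, hxK⟩, hxK⟩
  refine ⟨hsub, cubesUnion_subset_unitCube T, ⟨hconn.nonempty.mono hsub, ?_⟩,
    hlow.mono (Set.inter_subset_inter_left _ hsub), hup.mono (Set.inter_subset_inter_left _ hsub)⟩
  obtain ⟨x₀, hx₀⟩ := hconn.nonempty
  -- Each `y` lies in a convex cube `K` that meets `S`, so `S ∪ K` joins `y` to `x₀`.
  refine isPreconnected_of_forall x₀ fun y hy => ?_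
  obtain ⟨K, hK, hyK⟩ := Set.mem_iUnion₂.1 hy
  have hKpre : IsPreconnected (K : Set (Space n)) := by
    obtain ⟨_, j, rfl⟩ := K
    exact (convex_smallCube n k j).isPreconnected
  obtain ⟨z, hzS, hzK⟩ := hK.2
  exact ⟨S ∪ K, Set.union_subset hsub (Set.subset_biUnion_of_mem (u := fun K : cubes n k =>
    (K : Set (Space n))) hK), Or.inl hx₀, Or.inr hyK, hconn.isPreconnected.union z hzS hzK hKpre⟩

/-- A fibre of a map that encodes a coloring is covered by the cubes of one color. -/
lemma EncodesColoring.exists_color_cover {n k : ℕ} (hn : 1 ≤ n) (hk : 1 ≤ k)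
    {F : cubes n k → Fin n} {f : Space n → Space (n - 1)} (hf : EncodesColoring F f)
    (p : Space (n - 1)) :
    ∃ c : Fin n, unitCube n ∩ f ⁻¹' {p} ⊆ cubesUnion (F ⁻¹' {c}) := by
  by_cases hp : ∃ j, p j = 0
  · obtain ⟨j, hj⟩ := hp
    refine ⟨Fin.castLE (Nat.sub_le n 1) j, fun x ⟨hx, hxp⟩ => ?_⟩
    rw [← hf.2 j]
    exact ⟨hx, by rw [show f x = p from hxp, hj]⟩
  · refine ⟨⟨n - 1, by omega⟩, fun x ⟨hx, hxp⟩ => ?_⟩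
    obtain ⟨K, hK⟩ := exists_cube_of_mem_unitCube hk hx
    refine Set.mem_iUnion₂.2 ⟨K, ?_, hK⟩
    -- If `K` had one of the first `n - 1` colors, that coordinate of `f x = p` would vanish.
    by_contra hne
    have hlt : (F K : ℕ) < n - 1 := by
      have h1 := (F K).isLt
      have h2 : (F K : ℕ) ≠ n - 1 := fun h => hne (Fin.ext h)
      omega
    have hmem : x ∈ cubesUnion (F ⁻¹' {Fin.castLE (Nat.sub_le n 1) ⟨F K, hlt⟩}) :=
      Set.mem_iUnion₂.2 ⟨K, rfl, hK⟩
    rw [← hf.2] at hmem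
    exact hp ⟨_, (show f x = p from hxp) ▸ hmem.2⟩

lemma EncodesColoring.exists_connectsFaces {n k : ℕ} (hn : 1 ≤ n) (hk : 1 ≤ k)
    {F : cubes n k → Fin n} {f : Space n → Space (n - 1)} (hf : EncodesColoring F f)
    {p : Space (n - 1)} {S : Set (Space n)} {i : Fin n}
    (hSp : S ⊆ unitCube n ∩ f ⁻¹' {p}) (hS : ConnectsFaces i S) :
    ∃ (c : Fin n) (T : Set (cubes n k)),
      T ⊆ F ⁻¹' {c} ∧ S ⊆ cubesUnion T ∧ ConnectsFaces i (cubesUnion T) := by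
  obtain ⟨c, hc⟩ := hf.exists_color_cover hn hk p
  exact ⟨c, _, fun _ hK => hK.1, connectsFaces_cubesUnion_meeting hS (hSp.trans hc)⟩

lemma LevelSetTheorem.steinhausChessboardTheorem {n : ℕ} (hn : 1 ≤ n) (h : LevelSetTheorem n) :
    SteinhausChessboardTheorem n := by
  intro k hk F
  obtain ⟨f, hf⟩ := exists_encodesColoring F
  obtain ⟨p, S, -, hSp, i, hS⟩ := h f hf.1
  obtain ⟨c, T, hT, -, hconn⟩ := hf.exists_connectsFaces hn hk hSp hS
  exact ⟨c, T, hT, i, hconn⟩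

end LevelSetChess

theorem mainTheorem9 (n : ℕ) (hn : 1 ≤ n) :
    (LevelSetChess.LevelSetTheorem n → LevelSetChess.SteinhausChessboardTheorem n) ∧
    ∀ k : ℕ, 1 ≤ k → ∀ F : LevelSetChess.cubes n k → Fin n,
      (∃ f : LevelSetChess.Space n → LevelSetChess.Space (n - 1),
        LevelSetChess.EncodesColoring F f) ∧
      ∀ f : LevelSetChess.Space n → LevelSetChess.Space (n - 1),
        LevelSetChess.EncodesColoring F f →
        ∀ (p : LevelSetChess.Space (n - 1)) (S : Set (LevelSetChess.Space n)) (i : Fin n),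
          S ⊆ LevelSetChess.unitCube n ∩ f ⁻¹' {p} → LevelSetChess.ConnectsFaces i S →
          ∃ (c : Fin n) (T : Set (LevelSetChess.cubes n k)),
            T ⊆ F ⁻¹' {c} ∧ S ⊆ LevelSetChess.cubesUnion T ∧
              LevelSetChess.ConnectsFaces i (LevelSetChess.cubesUnion T) := by
  exact ⟨fun h => h.steinhausChessboardTheorem hn, fun k hk F =>
    ⟨LevelSetChess.exists_encodesColoring F, fun f hf p S i hSp hS =>
      hf.exists_connectsFaces hn hk hSp hS⟩⟩
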